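/- Let $\mathcal K:\mathbb R\to[0,\infty)$ be an even kernel with finite moments $\mathfrak m_j=\int_{\mathbb R}\xi^j\mathcal K(\xi)\,d\xi$ of every order $j\in\mathbb N$, normalized by $\mathfrak m_0=\mathfrak m_2=1$ and $\mathfrak m_1=0$. For $j\in\mathbb N$ and $W=(w_1,u_1,w_2,u_2,\sigma)\in\mathbb R^5$ with $\sigma>0$ put $$M_j(W)=\sum_{i=1}^2 w_i\Delta_j(u_i,\sigma),\qquad \Delta_j(u,\sigma)=\int_{\mathbb R}\xi^j\,\frac1\sigma\,\mathcal K\Big(\frac{\xi-u}{\sigma}\Big)\,d\xi ,$$ $\mathcal M(W)=(M_0(W),\dots,M_4(W))$, and $$\Omega=\{W: w_1,w_2>0,\ u_1<u_2,\ \sigma>0\},\qquad \Omega^{tot}=\{W: w_1,w_2>0,\ u_1\le u_2,\ \sigma>0\}.$$ The two-node EQMOM moment system closes the first five moment equations by a function $M_5=\mathcal M_5(M_0,\dots,M_4)$ on $\mathcal M(\Omega^{tot})$, where $\mathcal M_5(\mathcal M(W))=M_5(W)$ for all $W\in\Omega^{tot}$. Its coefficient matrix $A(M)\in\mathbb R^{5\times5}$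 has ones on the superdiagonal, last row $(a_0,\dots,a_4)$ and zeros elsewhere. Here $a_j(M)=\partial\mathcal M_5/\partial M_j$ for $M\in\mathcal M(\Omega)$, and the $a_j$ are extended to $\mathcal M(\Omega^{tot})$ (coinciding nodes) so that $W\mapsto a_j(\mathcal M(W))$ is continuous on $\Omega^{tot}$. The system is called strictly hyperbolic on $\mathcal M(\Omega^{tot})$ if the closure and its coefficients are well defined in this sense ($\mathcal M_5$ is a well-defined function on $\mathcal M(\Omega^{tot})$, is differentiable on $\mathcal M(\Omega)$, and the continuous extension exists) and $A(M)$ has five distinct real eigenvalues for every $M\in\mathcal M(\Omega^{tot})$. Theorem. The two-node EQMOM moment system is strictly hyperbolic on $\mathcal M(\Omega^{tot})$ if and only if $3\le\mathfrak m_4<6$. Moreover, in this case $\mathcal M$ is injective on $\Omega$. -/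

import Mathlib

open MeasureTheory Filter Topology

noncomputable section

namespace EQMOM

/-- The `j`-th moment `𝔪_j = ∫ ξ^j K(ξ) dξ` of a kernel. -/
def moment (K : ℝ → ℝ) (j : ℕ) : ℝ := ∫ ξ, ξ ^ j * K ξ

/-- A normalized kernel: nonnegative, with finite moments of every order, and
`𝔪_0 = 1`, `𝔪_1 = 0`, `𝔪_2 = 1`. -/
structure IsNormalizedKernel (K : ℝ → ℝ) : Prop where
  nonneg : ∀ ξ, 0 ≤ K ξ
  integrable : ∀ j : ℕ, Integrable (fun ξ : ℝ => ξ ^ j * K ξ)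
  moment_zero : moment K 0 = 1
  moment_one : moment K 1 = 0
  moment_two : moment K 2 = 1

/-- `Δ_j(u, σ)`: the `j`-th moment of the kernel with centre `u` and width `σ`. -/
def Delta (K : ℝ → ℝ) (j : ℕ) (u σ : ℝ) : ℝ :=
  ∫ ξ, ξ ^ j * (1 / σ * K ((ξ - u) / σ))

/-- The `j`-th moment of the two-node ansatz with parameters
`W = (w₁, u₁, w₂, u₂, σ)`. -/
def ansatzMoment (K : ℝ → ℝ) (j : ℕ) (W : Fin 5 → ℝ) : ℝ :=
  W 0 * Delta K j (W 1) (W 4) + W 2 * Delta K j (W 3) (W 4)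

/-- The two-node EQMOM map `W ↦ (M_0, …, M_4)`. -/
def momentMap (K : ℝ → ℝ) (W : Fin 5 → ℝ) : Fin 5 → ℝ :=
  fun j => ansatzMoment K (j : ℕ) W

/-- `Ω`: positive weights, distinct ordered nodes, positive width. -/
def Omega : Set (Fin 5 → ℝ) :=
  {W | 0 < W 0 ∧ 0 < W 2 ∧ W 1 < W 3 ∧ 0 < W 4}

/-- `Ω^{tot}`: as `Ω`, but the two nodes may coincide. -/
def OmegaTot : Set (Fin 5 → ℝ) :=
  {W | 0 < W 0 ∧ 0 < W 2 ∧ W 1 ≤ W 3 ∧ 0 < W 4}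

/-- `F` is the closure `M_5 = F(M_0, …, M_4)`. Such an `F` exists iff the fifth moment of the
ansatz is determined by its first five moments, i.e. iff the closure is well defined on
`𝓜(Ω^{tot})`, and its values there are then unique. -/
def IsClosure (K : ℝ → ℝ) (F : (Fin 5 → ℝ) → ℝ) : Prop :=
  ∀ W ∈ OmegaTot, F (momentMap K W) = ansatzMoment K 5 W

/-- `a = (a_0, …, a_4)` are the coefficients `a_j(M) = ∂F/∂M_j` of the closed system. On `𝓜(Ω)`
they are the partial derivatives of the closure. At the moments of coinciding nodes `F` is in
general not differentiable, and the coefficients are the continuous extension in the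
parameters `W`. -/
structure IsCoefficients (K : ℝ → ℝ) (F : (Fin 5 → ℝ) → ℝ)
    (a : (Fin 5 → ℝ) → (Fin 5 → ℝ)) : Prop where
  hasFDerivAt : ∀ W ∈ Omega, HasFDerivAt F
    (∑ j, a (momentMap K W) j • (ContinuousLinearMap.proj j : (Fin 5 → ℝ) →L[ℝ] ℝ))
    (momentMap K W)
  continuousOn : ContinuousOn (fun W => a (momentMap K W)) OmegaTot

/-- The coefficient matrix: ones on the superdiagonal, last row `(a_0, …, a_4)`, zeros
elsewhere. -/
def coeffMatrix (a : Fin 5 → ℝ) : Matrix (Fin 5) (Fin 5) ℝ :=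
  Matrix.of fun i j => if i = 4 then a j else if (j : ℕ) = (i : ℕ) + 1 then 1 else 0

/-- A real `5 × 5` matrix with five distinct real eigenvalues. -/
def HasDistinctRealEigenvalues (A : Matrix (Fin 5) (Fin 5) ℝ) : Prop :=
  ∃ l : Fin 5 → ℝ, Function.Injective l ∧
    ∀ i, Module.End.HasEigenvalue (Matrix.toLin' A) (l i)

/-- The two-node EQMOM moment system is (well defined and) strictly hyperbolic on
`𝓜(Ω^{tot})`. -/
def IsStrictlyHyperbolic (K : ℝ → ℝ) : Prop :=
  ∃ (F : (Fin 5 → ℝ) → ℝ) (a : (Fin 5 → ℝ) → (Fin 5 → ℝ)),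
    IsClosure K F ∧ IsCoefficients K F a ∧
    ∀ M ∈ momentMap K '' OmegaTot, HasDistinctRealEigenvalues (coeffMatrix (a M))

end EQMOM

end

open scoped Polynomial

noncomputable section

namespace EQMOM


/-! Write s = σ², κ = 𝔪₄ and D = 1 + s∂²/2 + κs²∂⁴/24. For j ≤ 5, Δ_j(u, σ) is the value of D xʲ at
u. Let P = x⁵ - ∑ a_j xʲ be the characteristic polynomial of the coefficient matrix. By the chain
rule, the weight and node derivatives say that DP has a double zero at each node, so DP = (x -
u₁)²(x - u₂)²(x - r); the σ-derivative determines r (`auxRoot`).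

Hence P is the image of this product under D⁻¹ = 1 - s∂²/2 + (6 - κ)s²∂⁴/24. For 3 ≤ κ < 6 and in
degree at most five, D⁻¹ = exp(-t∂²/2)(1 - g∂)(1 + g∂) with 12g⁴ = (κ - 3)s² and t = s - 2g² > 0.
The exponential turns multiplication by x - r into (x - r) - t∂, which yields simple real roots even
from repeated factors (`HasSimpleRealRoots.hermite_step`); the other factors preserve them
(`HasSimpleRealRoots.sub_derivative`).

For κ ≥ 3, with M₀, …, M₃ fixed, M₄ is strictly decreasing in the variance of the node measure
(`variance_not_lt`). So the moments determine the parameters, up to the splitting of the weight when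
the nodes coincide, and the closure exists. The Jacobian is invertible on `Omega`
(`eq_zero_of_explicitGrad`), so the closure is differentiable there.

Conversely, for κ < 3 two parameter vectors share M₀, …, M₄ but not M₅. For κ ≥ 6, coinciding nodes
at 0 with σ = 1 give P = x(x⁴ - 10x² + 30 - 5κ), which has at most three real roots. -/

/-! ### Polynomials with simple real roots -/

/-- `p` is the monic polynomial with the `n` distinct real roots `x 0 < ⋯ < x (n - 1)`. -/
def HasSimpleRealRoots (n : ℕ) (p : ℝ[X]) : Prop :=
  ∃ x : Fin n → ℝ, StrictMono x ∧ p = Lagrange.nodal Finset.univ x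

theorem HasSimpleRealRoots.monic {n : ℕ} {p : ℝ[X]} (h : HasSimpleRealRoots n p) :
    p.Monic := by
  obtain ⟨x, -, rfl⟩ := h
  exact Lagrange.nodal_monic

theorem HasSimpleRealRoots.natDegree {n : ℕ} {p : ℝ[X]} (h : HasSimpleRealRoots n p) :
    p.natDegree = n := by
  obtain ⟨x, -, rfl⟩ := h
  simp

/-- A monic polynomial of degree `m` which changes sign `m` times has `m` distinct real roots. -/
theorem hasSimpleRealRoots_of_sign_changes {m : ℕ} {f : ℝ[X]} (hf : f.Monic)
    (hdeg : f.natDegree = m) (z : Fin (m + 1) → ℝ)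
    (hz : ∀ i : Fin m, z i.castSucc < z i.succ ∧ f.eval (z i.castSucc) * f.eval (z i.succ) < 0) :
    HasSimpleRealRoots m f := by
  have hmono : StrictMono z := Fin.strictMono_iff_lt_succ.2 fun i => (hz i).1
  have hroot : ∀ i : Fin m, ∃ y, z i.castSucc < y ∧ y < z i.succ ∧ f.eval y = 0 := by
    intro i
    obtain ⟨hlt, hs⟩ := hz i
    have hc : ContinuousOn (fun x => f.eval x) (Set.Icc (z i.castSucc) (z i.succ)) :=
      f.continuous.continuousOn
    rcases mul_neg_iff.1 hs with ⟨h1, h2⟩ | ⟨h1, h2⟩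
    · obtain ⟨y, hy, h0⟩ := intermediate_value_Ioo' hlt.le hc ⟨h2, h1⟩
      exact ⟨y, hy.1, hy.2, h0⟩
    · obtain ⟨y, hy, h0⟩ := intermediate_value_Ioo hlt.le hc ⟨h1, h2⟩
      exact ⟨y, hy.1, hy.2, h0⟩
  choose y hy1 hy2 hy0 using hroot
  have hymono : StrictMono y := fun i j hij =>
    (hy2 i).trans (lt_of_le_of_lt (hmono.monotone (Fin.succ_le_castSucc_iff.2 hij)) (hy1 j))
  refine ⟨y, hymono, ?_⟩
  refine Polynomial.eq_of_degree_sub_lt_of_eval_index_eq Finset.univ hymono.injective.injOn ?_ ?_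
  · have hd : f.degree = (Lagrange.nodal Finset.univ y).degree := by
      rw [Lagrange.degree_nodal, Polynomial.degree_eq_natDegree hf.ne_zero, hdeg]
      simp
    have := Polynomial.degree_sub_lt_left hd hf.ne_zero
      (by rw [hf.leadingCoeff, Lagrange.nodal_monic.leadingCoeff])
    rwa [hd, Lagrange.degree_nodal] at this
  · intro i hi
    rw [hy0, Lagrange.eval_nodal_at_node hi]

/-- The derivative changes sign between consecutive roots. -/
theorem eval_derivative_nodal_mul_neg {m : ℕ} {x : Fin (m + 1) → ℝ} (hx : StrictMono x)
    (i : Fin m) :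
    (Lagrange.nodal Finset.univ x).derivative.eval (x i.castSucc) *
      (Lagrange.nodal Finset.univ x).derivative.eval (x i.succ) < 0 := by
  have hne : i.castSucc ≠ i.succ := (Fin.castSucc_lt_succ).ne
  rw [Lagrange.eval_nodal_derivative_eval_node_eq (Finset.mem_univ _),
    Lagrange.eval_nodal_derivative_eval_node_eq (Finset.mem_univ _), Lagrange.eval_nodal,
    Lagrange.eval_nodal,
    ← Finset.mul_prod_erase (Finset.univ.erase i.castSucc) _
      (Finset.mem_erase.2 ⟨hne.symm, Finset.mem_univ i.succ⟩),
    ← Finset.mul_prod_erase (Finset.univ.erase i.succ) _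
      (Finset.mem_erase.2 ⟨hne, Finset.mem_univ i.castSucc⟩),
    Finset.erase_right_comm, mul_mul_mul_comm, ← Finset.prod_mul_distrib]
  have hlt := hx (Fin.castSucc_lt_succ (i := i))
  -- No node lies between two consecutive ones, so each remaining paired factor is a product of two
  -- numbers of equal sign.
  refine mul_neg_of_neg_of_pos (mul_neg_of_neg_of_pos (by linarith) (by linarith))
    (Finset.prod_pos fun j hj => ?_)
  simp only [Finset.mem_erase, Finset.mem_univ, and_true] at hj
  rcases lt_or_gt_of_ne hj.1 with h | h
  · have h1 := hx h
    exact mul_pos (by linarith) (by linarith)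
  · have h1 := hx (lt_of_le_of_ne (Fin.castSucc_lt_iff_succ_le.1 h) hj.2.symm)
    exact mul_pos_of_neg_of_neg (by linarith) (by linarith)

theorem eval_derivative_nodal_last_pos {m : ℕ} {x : Fin (m + 1) → ℝ} (hx : StrictMono x) :
    0 < (Lagrange.nodal Finset.univ x).derivative.eval (x (Fin.last m)) := by
  rw [Lagrange.eval_nodal_derivative_eval_node_eq (Finset.mem_univ _), Lagrange.eval_nodal]
  refine Finset.prod_pos fun j hj => sub_pos.2 (hx ?_)
  exact lt_of_le_of_ne (Fin.le_last j) (Finset.ne_of_mem_erase hj)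

theorem eval_derivative_nodal_zero_mul_neg {m : ℕ} {x : Fin (m + 1) → ℝ} (hx : StrictMono x)
    {z : ℝ} (hz : z < x 0) :
    (Lagrange.nodal Finset.univ x).derivative.eval (x 0) *
      (Lagrange.nodal Finset.univ x).eval z < 0 := by
  rw [Lagrange.eval_nodal_derivative_eval_node_eq (Finset.mem_univ _), Lagrange.eval_nodal,
    Lagrange.eval_nodal, ← Finset.mul_prod_erase Finset.univ _ (Finset.mem_univ 0),
    mul_left_comm, ← Finset.prod_mul_distrib]
  refine mul_neg_of_neg_of_pos (by linarith) (Finset.prod_pos fun j hj => ?_)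
  have h1 := hx (lt_of_le_of_ne (Fin.zero_le j) (Finset.ne_of_mem_erase hj).symm)
  exact mul_pos_of_neg_of_neg (by linarith) (by linarith)

theorem _root_.Polynomial.Monic.exists_gt_eval_pos {q : ℝ[X]} (hq : q.Monic) (b : ℝ) :
    ∃ z, b < z ∧ 0 < q.eval z := by
  rcases Nat.eq_zero_or_pos q.natDegree with h | h
  · rw [Polynomial.Monic.natDegree_eq_zero hq] at h
    exact ⟨b + 1, by linarith, by simp [h]⟩
  · have ht := q.tendsto_atTop_of_leadingCoeff_nonneg
      (Polynomial.natDegree_pos_iff_degree_pos.1 h) (by rw [hq.leadingCoeff]; norm_num)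
    obtain ⟨z, h1, h2⟩ := ((ht.eventually_gt_atTop 0).and (eventually_gt_atTop b)).exists
    exact ⟨z, h2, h1⟩

theorem _root_.Polynomial.Monic.exists_lt_eval_pos {q : ℝ[X]} (hq : q.Monic) (b : ℝ) :
    ∃ z, z < b ∧ 0 < (-1) ^ q.natDegree * q.eval z := by
  have hm : (Polynomial.C ((-1) ^ q.natDegree) * q.comp (-Polynomial.X)).Monic := by
    have : (-Polynomial.X : ℝ[X]).natDegree = 1 := by simp
    rw [Polynomial.Monic, Polynomial.leadingCoeff_mul, Polynomial.leadingCoeff_comp (by simp),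
      hq.leadingCoeff]
    simp [← mul_pow]
  obtain ⟨z, h1, h2⟩ := hm.exists_gt_eval_pos (-b)
  exact ⟨-z, by linarith, by simpa using h2⟩

theorem HasSimpleRealRoots.X_sub_C (r : ℝ) :
    HasSimpleRealRoots 1 (Polynomial.X - Polynomial.C r) :=
  ⟨fun _ => r, Subsingleton.strictMono _, by simp [Lagrange.nodal]⟩

section
variable {m : ℕ} {p : ℝ[X]}

theorem mul_neg_of_mul_pos_of_mul_neg {a b d : ℝ} (h1 : 0 < a * b) (h2 : d * b < 0) :
    a * d < 0 := by
  rcases pos_and_pos_or_neg_and_neg_of_mul_pos h1 with ⟨ha, hb⟩ | ⟨ha, hb⟩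
  · exact mul_neg_of_pos_of_neg ha (by by_contra! h; nlinarith)
  · exact mul_neg_of_neg_of_pos ha (by by_contra! h; nlinarith)

theorem HasSimpleRealRoots.natDegree_derivative_lt (h : HasSimpleRealRoots (m + 1) p) :
    p.derivative.natDegree < m + 1 := by
  have := Polynomial.natDegree_derivative_lt (p := p) (by rw [h.natDegree]; omega)
  rwa [h.natDegree] at this

/-- `p ↦ (x - r) p - c p'` with `c > 0` preserves simple real-rootedness. -/
theorem HasSimpleRealRoots.hermite_step (h : HasSimpleRealRoots (m + 1) p) (r : ℝ) {c : ℝ}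
    (hc : 0 < c) : HasSimpleRealRoots (m + 2)
      ((Polynomial.X - Polynomial.C r) * p - Polynomial.C c * p.derivative) := by
  set q := (Polynomial.X - Polynomial.C r) * p - Polynomial.C c * p.derivative with hq
  have hm1 : ((Polynomial.X - Polynomial.C r) * p).Monic := (Polynomial.monic_X_sub_C r).mul h.monic
  have hd1 : ((Polynomial.X - Polynomial.C r) * p).natDegree = m + 2 := by
    rw [(Polynomial.monic_X_sub_C r).natDegree_mul h.monic, h.natDegree,
      Polynomial.natDegree_X_sub_C]
    omega
  have hlt : (Polynomial.C c * p.derivative).natDegree <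
      ((Polynomial.X - Polynomial.C r) * p).natDegree := by
    rw [hd1]
    have := Polynomial.natDegree_C_mul_le c p.derivative
    have := h.natDegree_derivative_lt
    omega
  have hdlt := Polynomial.degree_lt_degree hlt
  have hqm : q.Monic := hm1.sub_of_left hdlt
  have hqd : q.natDegree = m + 2 := by
    rw [hq, Polynomial.natDegree_sub_eq_left_of_natDegree_lt hlt, hd1]
  have hpm := h.monic
  have hpd := h.natDegree
  obtain ⟨x, hx, hpx⟩ := h
  have hqx : ∀ i, q.eval (x i) = -(c * p.derivative.eval (x i)) := by
    intro i
    have : p.eval (x i) = 0 := by rw [hpx, Lagrange.eval_nodal_at_node (Finset.mem_univ i)]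
    simp [hq, this]
  obtain ⟨zr, hzr, hqr⟩ := hqm.exists_gt_eval_pos (x (Fin.last m))
  -- The product `q * p` has odd degree 2m + 3, which gives the sign of `q` relative to `p` on the
  -- left without a parity split.
  obtain ⟨zl, hzl, hql⟩ := (hqm.mul hpm).exists_lt_eval_pos (x 0)
  rw [hqm.natDegree_mul hpm, hqd, hpd, Polynomial.eval_mul, Odd.neg_one_pow ⟨m + 1, by ring⟩] at hql
  have hbot := eval_derivative_nodal_zero_mul_neg hx hzl
  have htop := eval_derivative_nodal_last_pos hx
  rw [← hpx] at hbot htop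
  -- At the roots of `p`, `q = -c p'` alternates in sign; since `c > 0`, each end contributes one
  -- further sign change.
  refine hasSimpleRealRoots_of_sign_changes hqm hqd
    (Fin.cons zl (Fin.snoc x zr : Fin (m + 2) → ℝ)) fun i => ?_
  refine Fin.cases ?_ (fun i => ?_) i
  · have h0 : (Fin.snoc x zr : Fin (m + 2) → ℝ) 0 = x 0 :=
      Fin.snoc_castSucc (α := fun _ => ℝ) zr x 0
    rw [Fin.castSucc_zero, Fin.cons_zero, Fin.cons_succ, h0]
    refine ⟨hzl, ?_⟩
    rw [hqx]
    have := mul_neg_of_mul_pos_of_mul_neg (a := -q.eval zl) (by linarith) hbot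
    nlinarith
  · rw [Fin.castSucc_succ, Fin.cons_succ, Fin.cons_succ]
    refine Fin.lastCases ?_ (fun i => ?_) i
    · rw [Fin.snoc_castSucc, Fin.succ_last, Fin.snoc_last, hqx]
      exact ⟨hzr, mul_neg_of_neg_of_pos (by nlinarith) hqr⟩
    · rw [Fin.snoc_castSucc, Fin.succ_castSucc, Fin.snoc_castSucc, hqx, hqx]
      have := eval_derivative_nodal_mul_neg hx i
      rw [← hpx] at this
      refine ⟨hx Fin.castSucc_lt_succ, ?_⟩
      nlinarith [mul_pos hc hc]

theorem HasSimpleRealRoots.monic_sub_derivative (h : HasSimpleRealRoots (m + 1) p) (c : ℝ) :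
    (p - Polynomial.C c * p.derivative).Monic ∧
      (p - Polynomial.C c * p.derivative).natDegree = m + 1 := by
  have hlt : (Polynomial.C c * p.derivative).natDegree < p.natDegree := by
    have := Polynomial.natDegree_C_mul_le c p.derivative
    have := h.natDegree_derivative_lt
    have := h.natDegree
    omega
  exact ⟨h.monic.sub_of_left (Polynomial.degree_lt_degree hlt), by
    rw [Polynomial.natDegree_sub_eq_left_of_natDegree_lt hlt, h.natDegree]⟩

/-- `p ↦ p - c p'` preserves simple real-rootedness. -/
theorem HasSimpleRealRoots.sub_derivative (h : HasSimpleRealRoots (m + 1) p) (c : ℝ) :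
    HasSimpleRealRoots (m + 1) (p - Polynomial.C c * p.derivative) := by
  obtain ⟨hqm, hqd⟩ := h.monic_sub_derivative c
  have hpm := h.monic
  have hpd := h.natDegree
  rcases eq_or_ne c 0 with rfl | hc0
  · simpa using h
  set q := p - Polynomial.C c * p.derivative with hq
  obtain ⟨x, hx, hpx⟩ := h
  have hqx : ∀ i, q.eval (x i) = -(c * p.derivative.eval (x i)) := by
    intro i
    have : p.eval (x i) = 0 := by rw [hpx, Lagrange.eval_nodal_at_node (Finset.mem_univ i)]
    simp [hq, this]
  have hmid : ∀ i : Fin m, x i.castSucc < x i.succ ∧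
      q.eval (x i.castSucc) * q.eval (x i.succ) < 0 := by
    intro i
    rw [hqx, hqx]
    have := eval_derivative_nodal_mul_neg hx i
    rw [← hpx] at this
    refine ⟨hx Fin.castSucc_lt_succ, ?_⟩
    nlinarith [mul_self_pos.2 hc0]
  -- The one missing sign change lies to the left of all roots if `c < 0`, and to the right if `c >
  -- 0`.
  rcases lt_or_gt_of_ne hc0 with hc | hc
  · obtain ⟨zl, hzl, hql⟩ := (hqm.mul hpm).exists_lt_eval_pos (x 0)
    rw [hqm.natDegree_mul hpm, hqd, hpd, Polynomial.eval_mul, Even.neg_one_pow ⟨m + 1, by ring⟩]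
      at hql
    have hbot := eval_derivative_nodal_zero_mul_neg hx hzl
    rw [← hpx] at hbot
    refine hasSimpleRealRoots_of_sign_changes hqm hqd (Fin.cons zl x) fun i => ?_
    refine Fin.cases ?_ (fun i => ?_) i
    · rw [Fin.castSucc_zero, Fin.cons_zero, Fin.cons_succ]
      refine ⟨hzl, ?_⟩
      rw [hqx]
      have := mul_neg_of_mul_pos_of_mul_neg (a := q.eval zl) (by linarith) hbot
      nlinarith
    · rw [Fin.castSucc_succ, Fin.cons_succ, Fin.cons_succ]
      exact hmid i
  · obtain ⟨zr, hzr, hqr⟩ := hqm.exists_gt_eval_pos (x (Fin.last m))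
    have htop := eval_derivative_nodal_last_pos hx
    rw [← hpx] at htop
    refine hasSimpleRealRoots_of_sign_changes hqm hqd (Fin.snoc x zr : Fin (m + 2) → ℝ) fun i => ?_
    refine Fin.lastCases ?_ (fun i => ?_) i
    · rw [Fin.snoc_castSucc, Fin.succ_last, Fin.snoc_last, hqx]
      exact ⟨hzr, mul_neg_of_neg_of_pos (by nlinarith) hqr⟩
    · rw [Fin.snoc_castSucc, Fin.succ_castSucc, Fin.snoc_castSucc]
      exact hmid i


end

/-! ### Closed form of the moments -/

/-- The moments `Δ_0, …, Δ_5` of an even normalized kernel with fourth moment `κ`. -/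
def explicitDelta (κ u σ : ℝ) : Fin 6 → ℝ :=
  ![1, u, u ^ 2 + σ ^ 2, u ^ 3 + 3 * u * σ ^ 2, u ^ 4 + 6 * u ^ 2 * σ ^ 2 + κ * σ ^ 4,
    u ^ 5 + 10 * u ^ 3 * σ ^ 2 + 5 * κ * u * σ ^ 4]

/-- The moments of the ansatz in terms of the fourth moment `κ` of the kernel. -/
def explicitMoment (κ : ℝ) (j : Fin 6) (W : Fin 5 → ℝ) : ℝ :=
  W 0 * explicitDelta κ (W 1) (W 4) j + W 2 * explicitDelta κ (W 3) (W 4) j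

theorem Delta_eq_integral (K : ℝ → ℝ) (j : ℕ) (u : ℝ) {σ : ℝ} (hσ : 0 < σ) :
    Delta K j u σ = ∫ η, (u + σ * η) ^ j * K η := by
  have h1 : Delta K j u σ = ∫ ξ, (ξ + u) ^ j * (1 / σ * K (ξ / σ)) := by
    rw [Delta, ← integral_add_right_eq_self _ u]
    simp
  have h2 := Measure.integral_comp_div (fun η => (σ * η + u) ^ j * (1 / σ * K η)) σ
  rw [h1]
  have h3 : ∀ ξ, (ξ + u) ^ j * (1 / σ * K (ξ / σ)) =
      (σ * (ξ / σ) + u) ^ j * (1 / σ * K (ξ / σ)) := fun ξ => by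
    rw [mul_div_cancel₀ _ hσ.ne']
  simp_rw [h3]
  rw [h2, abs_of_pos hσ, smul_eq_mul, ← integral_const_mul]
  congr 1
  ext η
  rw [add_comm u]
  field_simp

theorem moment_eq_zero_of_odd {K : ℝ → ℝ} (heven : ∀ ξ, K (-ξ) = K ξ) {j : ℕ} (hj : Odd j) :
    moment K j = 0 := by
  have h := integral_neg_eq_self (fun ξ => ξ ^ j * K ξ) volume
  simp only [heven, hj.neg_pow, neg_mul, integral_neg] at h
  rw [moment]
  linarith

theorem Delta_eq_sum {K : ℝ → ℝ} (hK : IsNormalizedKernel K) (j : ℕ) (u : ℝ) {σ : ℝ}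
    (hσ : 0 < σ) :
    Delta K j u σ =
      ∑ k ∈ Finset.range (j + 1), σ ^ k * u ^ (j - k) * (j.choose k) * moment K k := by
  rw [Delta_eq_integral K j u hσ]
  have : ∀ η, (u + σ * η) ^ j * K η = ∑ k ∈ Finset.range (j + 1),
      (σ ^ k * u ^ (j - k) * (j.choose k)) * (η ^ k * K η) := by
    intro η
    rw [add_comm, add_pow, Finset.sum_mul]
    exact Finset.sum_congr rfl fun k _ => by rw [mul_pow]; ring
  simp_rw [this]
  rw [integral_finsetSum _ fun k _ => (hK.integrable k).const_mul _]
  simp_rw [integral_const_mul, moment]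

theorem Delta_eq_explicitDelta {K : ℝ → ℝ} (hK : IsNormalizedKernel K)
    (heven : ∀ ξ, K (-ξ) = K ξ) (j : Fin 6) (u : ℝ) {σ : ℝ} (hσ : 0 < σ) :
    Delta K j u σ = explicitDelta (moment K 4) u σ j := by
  have h0 := hK.moment_zero
  have h1 := hK.moment_one
  have h2 := hK.moment_two
  have h3 : moment K 3 = 0 := moment_eq_zero_of_odd heven (by decide)
  have h5 : moment K 5 = 0 := moment_eq_zero_of_odd heven (by decide)
  rw [Delta_eq_sum hK j u hσ]
  fin_cases j <;>
    simp [explicitDelta, Finset.sum_range_succ, h0, h1, h2, h3, h5, Nat.choose] <;> ring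

theorem ansatzMoment_eq {K : ℝ → ℝ} (hK : IsNormalizedKernel K)
    (heven : ∀ ξ, K (-ξ) = K ξ) (j : Fin 6) {W : Fin 5 → ℝ} (hσ : 0 < W 4) :
    ansatzMoment K j W = explicitMoment (moment K 4) j W := by
  rw [ansatzMoment, explicitMoment, Delta_eq_explicitDelta hK heven j _ hσ,
    Delta_eq_explicitDelta hK heven j _ hσ]

theorem momentMap_eq {K : ℝ → ℝ} (hK : IsNormalizedKernel K)
    (heven : ∀ ξ, K (-ξ) = K ξ) {W : Fin 5 → ℝ} (hσ : 0 < W 4) :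
    momentMap K W = fun j => explicitMoment (moment K 4) j.castSucc W :=
  funext fun j => ansatzMoment_eq hK heven j.castSucc hσ

theorem moment_four_nonneg {K : ℝ → ℝ} (hK : IsNormalizedKernel K) : 0 ≤ moment K 4 :=
  integral_nonneg fun ξ => mul_nonneg (by positivity) (hK.nonneg ξ)


/-! ### Recovering the parameters from the moments -/

/-- The variance of the two-point measure and the width are determined by the moments. -/
theorem variance_not_lt {κ v v' s s' q k k' : ℝ} (hκ : 3 ≤ κ) (hv : 0 ≤ v)
    (hs' : 0 < s')
    (hk : k * v = q ^ 2 + v ^ 3) (hk' : k' * v' = q ^ 2 + v' ^ 3) (h0 : v = 0 → k = 0)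
    (h2 : v + s = v' + s')
    (h4 : k + 6 * s * v + κ * s ^ 2 = k' + 6 * s' * v' + κ * s' ^ 2) : ¬ v < v' := by
  intro hlt
  have hv' : 0 < v' := hv.trans_lt hlt
  have hs : s = v' + s' - v := by linarith
  subst hs
  -- With T = v + s fixed, v² + 6(T - v)v + κ(T - v)² changes by (v' - v) times this bracket, so it
  -- decreases. Then `h4` forces k - v² to increase, although for v > 0 it equals q²/v, which cannot
  -- increase with v.
  have hbr : (κ - 5) * (v + v') + (6 - 2 * κ) * (v' + s') < 0 := by
    nlinarith [mul_nonneg (sub_nonneg.2 hκ) (show 0 ≤ 2 * (v' + s') - (v + v') by linarith)]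
  have hA : k - v ^ 2 < k' - v' ^ 2 := by
    nlinarith [mul_pos_of_neg_of_neg (sub_neg.2 hlt) hbr]
  have hA' : 0 ≤ k' - v' ^ 2 := by
    refine nonneg_of_mul_nonneg_left (b := v') ?_ hv'
    nlinarith [sq_nonneg q]
  have hAA : (k - v ^ 2) * v = (k' - v' ^ 2) * v' := by linear_combination hk - hk'
  rcases hv.eq_or_lt with hv0 | hv0
  · subst hv0
    have := h0 rfl
    subst this
    nlinarith
  · nlinarith [mul_lt_mul_of_pos_right hA hv0, mul_le_mul_of_nonneg_left hlt.le hA']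

/-- Central moments of a two-point measure with weights `w₁, w₂`, written in terms of the mean `m`
and the normalized distance of the nodes. -/
theorem exists_central_moments {w₁ u₁ w₂ u₂ : ℝ} (κ s : ℝ) (h1 : 0 < w₁) (h2 : 0 < w₂)
    {m : ℝ} (hm : w₁ * u₁ + w₂ * u₂ = (w₁ + w₂) * m) :
    ∃ v q k : ℝ, 0 ≤ v ∧ k * v = q ^ 2 + v ^ 3 ∧ (v = 0 → k = 0) ∧
      w₁ * (u₁ ^ 2 + s) + w₂ * (u₂ ^ 2 + s) = (w₁ + w₂) * (v + s + m ^ 2) ∧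
      w₁ * (u₁ ^ 3 + 3 * u₁ * s) + w₂ * (u₂ ^ 3 + 3 * u₂ * s) =
        (w₁ + w₂) * (q + 3 * m * (v + s) + m ^ 3) ∧
      w₁ * (u₁ ^ 4 + 6 * u₁ ^ 2 * s + κ * s ^ 2) + w₂ * (u₂ ^ 4 + 6 * u₂ ^ 2 * s + κ * s ^ 2) =
        (w₁ + w₂) * (k + 6 * s * v + κ * s ^ 2 + 4 * m * q + 6 * m ^ 2 * (v + s) + m ^ 4) := by
  have hn : w₁ + w₂ ≠ 0 := by positivity
  obtain ⟨t, ht⟩ : ∃ t, t * (w₁ + w₂) = u₂ - u₁ := ⟨_, div_mul_cancel₀ _ hn⟩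
  have e1 : u₁ = m - w₂ * t := mul_left_cancel₀ hn (by linear_combination hm + w₂ * ht)
  have e2 : u₂ = m + w₁ * t := mul_left_cancel₀ hn (by linear_combination hm - w₁ * ht)
  refine ⟨w₁ * w₂ * t ^ 2, w₁ * w₂ * (w₁ - w₂) * t ^ 3,
    w₁ * w₂ * (w₁ ^ 2 - w₁ * w₂ + w₂ ^ 2) * t ^ 4, by positivity, by ring, fun h => ?_, ?_, ?_, ?_⟩
  · have : t ^ 2 = 0 := (mul_eq_zero.1 h).resolve_left (mul_pos h1 h2).ne'
    rw [pow_eq_zero_iff two_ne_zero] at this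
    simp [this]
  all_goals subst e1 e2; ring

/-- Two two-point measures with distinct nodes and equal moments up to order three agree. -/
theorem nodes_eq {w₁ u₁ w₂ u₂ w₁' u₁' w₂' u₂' : ℝ} (hu : u₁ < u₂)
    (h1' : 0 < w₁') (h2' : 0 < w₂') (hu' : u₁' < u₂')
    (m0 : w₁ + w₂ = w₁' + w₂') (m1 : w₁ * u₁ + w₂ * u₂ = w₁' * u₁' + w₂' * u₂')
    (m2 : w₁ * u₁ ^ 2 + w₂ * u₂ ^ 2 = w₁' * u₁' ^ 2 + w₂' * u₂' ^ 2)
    (m3 : w₁ * u₁ ^ 3 + w₂ * u₂ ^ 3 = w₁' * u₁' ^ 3 + w₂' * u₂' ^ 3) :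
    w₁ = w₁' ∧ u₁ = u₁' ∧ w₂ = w₂' ∧ u₂ = u₂' := by
  -- The polynomials (x - u₁)(x - u₂) and x(x - u₁)(x - u₂) integrate to zero against the first
  -- measure, hence against the second.
  have e0 : w₁' * ((u₁' - u₁) * (u₁' - u₂)) + w₂' * ((u₂' - u₁) * (u₂' - u₂)) = 0 := by
    linear_combination (-u₁ * u₂) * m0 + (u₁ + u₂) * m1 - m2
  have e1 : w₁' * u₁' * ((u₁' - u₁) * (u₁' - u₂)) + w₂' * u₂' * ((u₂' - u₁) * (u₂' - u₂)) = 0 := by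
    linear_combination (-u₁ * u₂) * m1 + (u₁ + u₂) * m2 - m3
  have f1 : (u₁' - u₁) * (u₁' - u₂) = 0 := by
    have : w₁' * (u₁' - u₂') * ((u₁' - u₁) * (u₁' - u₂)) = 0 := by
      linear_combination e1 - u₂' * e0
    exact (mul_eq_zero.1 this).resolve_left (mul_ne_zero h1'.ne' (by linarith))
  have f2 : (u₂' - u₁) * (u₂' - u₂) = 0 := by
    have : w₂' * (u₂' - u₁') * ((u₂' - u₁) * (u₂' - u₂)) = 0 := by
      linear_combination e1 - u₁' * e0
    exact (mul_eq_zero.1 this).resolve_left (mul_ne_zero h2'.ne' (by linarith))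
  have hn : u₁' = u₁ ∧ u₂' = u₂ := by
    rcases mul_eq_zero.1 f1 with h | h <;> rcases mul_eq_zero.1 f2 with g | g <;>
      exact ⟨by linarith, by linarith⟩
  obtain ⟨rfl, rfl⟩ := hn
  have hd : (w₁ - w₁') * (u₂' - u₁') = 0 := by linear_combination u₂' * m0 - m1
  have hw : w₁ = w₁' := by
    have := (mul_eq_zero.1 hd).resolve_right (by linarith)
    linarith
  exact ⟨hw, rfl, by linarith, rfl⟩

/-- Parameters with the same moments `M_0, …, M_4` either agree, or both have coinciding nodes and
agree up to the distribution of the weight. -/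
theorem parameters_eq {κ w₁ u₁ w₂ u₂ σ w₁' u₁' w₂' u₂' σ' : ℝ} (hκ : 3 ≤ κ) (h1 : 0 < w₁)
    (h2 : 0 < w₂) (hu : u₁ ≤ u₂) (hσ : 0 < σ) (h1' : 0 < w₁') (h2' : 0 < w₂') (hu' : u₁' ≤ u₂')
    (hσ' : 0 < σ')
    (m0 : w₁ + w₂ = w₁' + w₂') (m1 : w₁ * u₁ + w₂ * u₂ = w₁' * u₁' + w₂' * u₂')
    (m2 : w₁ * (u₁ ^ 2 + σ ^ 2) + w₂ * (u₂ ^ 2 + σ ^ 2) =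
      w₁' * (u₁' ^ 2 + σ' ^ 2) + w₂' * (u₂' ^ 2 + σ' ^ 2))
    (m3 : w₁ * (u₁ ^ 3 + 3 * u₁ * σ ^ 2) + w₂ * (u₂ ^ 3 + 3 * u₂ * σ ^ 2) =
      w₁' * (u₁' ^ 3 + 3 * u₁' * σ' ^ 2) + w₂' * (u₂' ^ 3 + 3 * u₂' * σ' ^ 2))
    (m4 : w₁ * (u₁ ^ 4 + 6 * u₁ ^ 2 * σ ^ 2 + κ * σ ^ 4) +
        w₂ * (u₂ ^ 4 + 6 * u₂ ^ 2 * σ ^ 2 + κ * σ ^ 4) =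
      w₁' * (u₁' ^ 4 + 6 * u₁' ^ 2 * σ' ^ 2 + κ * σ' ^ 4) +
        w₂' * (u₂' ^ 4 + 6 * u₂' ^ 2 * σ' ^ 2 + κ * σ' ^ 4)) :
    σ = σ' ∧ ((w₁ = w₁' ∧ u₁ = u₁' ∧ w₂ = w₂' ∧ u₂ = u₂') ∨
      (u₁ = u₂ ∧ u₁' = u₁ ∧ u₂' = u₁)) := by
  have hσσ : σ = σ' := by
    have hn : w₁ + w₂ ≠ 0 := by positivity
    obtain ⟨m, hm⟩ : ∃ m, w₁ * u₁ + w₂ * u₂ = (w₁ + w₂) * m := ⟨_, (mul_div_cancel₀ _ hn).symm⟩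
    obtain ⟨v, q, k, hv, hk, h0, a2, a3, a4⟩ := exists_central_moments κ (σ ^ 2) h1 h2 hm
    obtain ⟨v', q', k', hv', hk', h0', b2, b3, b4⟩ :=
      exists_central_moments κ (σ' ^ 2) h1' h2' (m := m) (by rw [← m1, hm, m0])
    have c2 : v + σ ^ 2 = v' + σ' ^ 2 :=
      mul_left_cancel₀ hn (by linear_combination m2 - a2 + b2 - (v' + σ' ^ 2 + m ^ 2) * m0)
    have c3 : q = q' := mul_left_cancel₀ hn (by
      linear_combination m3 - a3 + b3 - (q' + 3 * m * (v' + σ' ^ 2) + m ^ 3) * m0 -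
        3 * m * (w₁ + w₂) * c2)
    subst c3
    have c4 : k + 6 * σ ^ 2 * v + κ * (σ ^ 2) ^ 2 = k' + 6 * σ' ^ 2 * v' + κ * (σ' ^ 2) ^ 2 :=
      mul_left_cancel₀ hn (by
        linear_combination m4 - a4 + b4 - (k' + 6 * σ' ^ 2 * v' + κ * (σ' ^ 2) ^ 2 + 4 * m * q +
          6 * m ^ 2 * (v' + σ' ^ 2) + m ^ 4) * m0 - 6 * m ^ 2 * (w₁ + w₂) * c2)
    have n1 := variance_not_lt hκ hv (pow_pos hσ' 2) hk hk' h0 c2 c4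
    have n2 := variance_not_lt hκ hv' (pow_pos hσ 2) hk' hk h0' c2.symm c4.symm
    have hvv : v = v' := le_antisymm (not_lt.1 n2) (not_lt.1 n1)
    have hs : σ ^ 2 = σ' ^ 2 := by linarith
    exact (sq_eq_sq₀ hσ.le hσ'.le).1 hs
  subst hσσ
  refine ⟨rfl, ?_⟩
  have n2 : w₁ * u₁ ^ 2 + w₂ * u₂ ^ 2 = w₁' * u₁' ^ 2 + w₂' * u₂' ^ 2 := by
    linear_combination m2 - σ ^ 2 * m0
  have n3 : w₁ * u₁ ^ 3 + w₂ * u₂ ^ 3 = w₁' * u₁' ^ 3 + w₂' * u₂' ^ 3 := by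
    linear_combination m3 - 3 * σ ^ 2 * m1
  -- Both sides are m₀m₂ - m₁² of the node measures, which vanishes exactly when the nodes coincide.
  have hdisc : w₁ * w₂ * (u₂ - u₁) ^ 2 = w₁' * w₂' * (u₂' - u₁') ^ 2 := by
    linear_combination (w₁ * u₁ ^ 2 + w₂ * u₂ ^ 2) * m0 + (w₁' + w₂') * n2 -
      (w₁ * u₁ + w₂ * u₂ + w₁' * u₁' + w₂' * u₂') * m1
  rcases hu.lt_or_eq with hlt | heq
  · left
    refine nodes_eq hlt h1' h2' (lt_of_le_of_ne hu' ?_) m0 m1 n2 n3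
    rintro rfl
    have : 0 < w₁ * w₂ * (u₂ - u₁) ^ 2 :=
      mul_pos (mul_pos h1 h2) (pow_pos (sub_pos.2 hlt) 2)
    rw [hdisc] at this
    simp at this
  · right
    subst heq
    have h0 : w₁' * w₂' * (u₂' - u₁') ^ 2 = 0 := by rw [← hdisc]; simp
    have he : u₂' = u₁' := by
      have := (mul_eq_zero.1 h0).resolve_left (mul_pos h1' h2').ne'
      have := pow_eq_zero_iff (two_ne_zero) |>.1 this
      linarith
    subst he
    have : (w₁ + w₂) * (u₂' - u₁) = 0 := by linear_combination u₂' * m0 - m1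
    have := (mul_eq_zero.1 this).resolve_left (by positivity)
    exact ⟨rfl, by linarith, by linarith⟩


/-! ### Failure of the closure for κ < 3 -/

/-- A two-node ansatz with prescribed central moments. -/
theorem exists_mem_Omega_explicitMoment (κ p : ℝ) {v σ : ℝ} (hv : 0 < v) (hσ : 0 < σ) :
    ∃ W ∈ Omega, ∀ j, explicitMoment κ j W =
      ![1, 0, v + σ ^ 2, p * v, v ^ 2 + p ^ 2 * v + 6 * σ ^ 2 * v + κ * σ ^ 4,
        p ^ 3 * v + 2 * p * v ^ 2 + 10 * σ ^ 2 * (p * v)] j := by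
  -- The nodes (p ± R)/2 are the roots of x² - px - v, so the node moments satisfy m_{n+2} = p
  -- m_{n+1} + v m_n.
  set R := √(p ^ 2 + 4 * v) with hR
  have hR2 : R ^ 2 = p ^ 2 + 4 * v := Real.sq_sqrt (by positivity)
  have hR0 : 0 < R := Real.sqrt_pos.2 (by positivity)
  have habs : |p| < R := by
    rw [hR, ← Real.sqrt_sq_eq_abs]
    exact Real.sqrt_lt_sqrt (sq_nonneg p) (by linarith)
  obtain ⟨hp1, hp2⟩ := abs_lt.1 habs
  have hv' : v = (R ^ 2 - p ^ 2) / 4 := by linarith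
  refine ⟨![(p + R) / 2 / R, (p - R) / 2, (R - p) / 2 / R, (p + R) / 2, σ],
    ⟨?_, ?_, ?_, hσ⟩, fun j => ?_⟩
  · exact div_pos (by linarith) hR0
  · exact div_pos (by linarith) hR0
  · change (p - R) / 2 < (p + R) / 2
    linarith
  · rw [hv']
    fin_cases j <;> simp [explicitMoment, explicitDelta] <;> field_simp <;> ring

/-- For `κ < 3` the fifth moment is not determined by the first five. -/
theorem exists_explicitMoment_five_ne {κ : ℝ} (h0 : 0 ≤ κ) (h3 : κ < 3) :
    ∃ W ∈ Omega, ∃ W' ∈ Omega,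
      (∀ j : Fin 5, explicitMoment κ j.castSucc W = explicitMoment κ j.castSucc W') ∧
      explicitMoment κ 5 W ≠ explicitMoment κ 5 W' := by
  -- Total variance 1 is split as t + (1 - t) and as 2t + (1 - 2t). Halving p keeps the third moment
  -- pv; equality of the fourth moments determines p², and this t makes it positive.
  obtain ⟨t, ht⟩ : ∃ t, t = (3 - κ) / 10 := ⟨_, rfl⟩
  have ht0 : 0 < t := by linarith
  have ht1 : 2 * t < 1 := by linarith
  have hκ : κ = 3 - 10 * t := by linarith
  have hL : 0 < (κ - 5) * (3 * t) + 6 - 2 * κ := by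
    subst hκ; nlinarith
  obtain ⟨p, hp0, hp⟩ : ∃ p, 0 < p ∧ p ^ 2 = 2 * ((κ - 5) * (3 * t) + 6 - 2 * κ) :=
    ⟨√(2 * ((κ - 5) * (3 * t) + 6 - 2 * κ)), Real.sqrt_pos.2 (by linarith),
      Real.sq_sqrt (by linarith)⟩
  have e1 : √(1 - t) ^ 2 = 1 - t := Real.sq_sqrt (by linarith)
  have e2 : √(1 - 2 * t) ^ 2 = 1 - 2 * t := Real.sq_sqrt (by linarith)
  have e1' : √(1 - t) ^ 4 = (1 - t) ^ 2 := by linear_combination (√(1 - t) ^ 2 + (1 - t)) * e1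
  have e2' : √(1 - 2 * t) ^ 4 = (1 - 2 * t) ^ 2 := by
    linear_combination (√(1 - 2 * t) ^ 2 + (1 - 2 * t)) * e2
  obtain ⟨W, hW, hM⟩ := exists_mem_Omega_explicitMoment κ p ht0
    (Real.sqrt_pos.2 (show 0 < 1 - t by linarith))
  obtain ⟨W', hW', hM'⟩ := exists_mem_Omega_explicitMoment κ (p / 2) (v := 2 * t)
    (by linarith) (Real.sqrt_pos.2 (show 0 < 1 - 2 * t by linarith))
  refine ⟨W, hW, W', hW', fun j => ?_, ?_⟩
  · rw [hM, hM', e1, e1', e2, e2']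
    fin_cases j
    · simp
    · simp
    · simp
    · simp; ring
    · simp
      linear_combination (t / 2) * hp
  · rw [hM, hM', e1, e2]
    simp
    intro h
    have : p * t * (3 / 4 * p ^ 2 + 8 * t) = 0 := by linear_combination h
    have h2 : 0 < p * t * (3 / 4 * p ^ 2 + 8 * t) := by positivity
    exact h2.ne' this

/-! ### The characteristic polynomial and its roots -/

/-- Companion matrix: an eigenvector for `l` is a multiple of (1, l, …, l⁴). -/
theorem hasEigenvalue_coeffMatrix_iff (a : Fin 5 → ℝ) (l : ℝ) :
    Module.End.HasEigenvalue (Matrix.toLin' (coeffMatrix a)) l ↔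
      l ^ 5 = ∑ j : Fin 5, a j * l ^ (j : ℕ) := by
  have hmul : ∀ v : Fin 5 → ℝ, (coeffMatrix a).mulVec v = ![v 1, v 2, v 3, v 4, ∑ j, a j * v j] := by
    intro v
    ext i
    fin_cases i <;> simp [coeffMatrix, Matrix.mulVec, dotProduct, Fin.sum_univ_five]
  constructor
  · intro h
    obtain ⟨v, hv⟩ := h.exists_hasEigenvector
    have he := hv.apply_eq_smul
    rw [Matrix.toLin'_apply, hmul] at he
    have e0 : v 1 = l * v 0 := by simpa using congrFun he 0
    have e1 : v 2 = l * v 1 := by simpa using congrFun he 1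
    have e2 : v 3 = l * v 2 := by simpa using congrFun he 2
    have e3 : v 4 = l * v 3 := by simpa using congrFun he 3
    have e4 : ∑ j, a j * v j = l * v 4 := by simpa using congrFun he 4
    have h0 : v 0 ≠ 0 := by
      intro h0
      refine hv.2 (funext fun i => ?_)
      fin_cases i <;> simp [e0, e1, e2, e3, h0]
    apply mul_right_cancel₀ h0
    rw [Fin.sum_univ_five] at e4 ⊢
    rw [e3, e2, e1, e0] at e4
    simp [-mul_eq_mul_right_iff]
    linear_combination -e4
  · intro h
    refine Module.End.hasEigenvalue_of_hasEigenvector (x := fun j : Fin 5 => l ^ (j : ℕ))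
      ⟨Module.End.mem_eigenspace_iff.2 ?_, fun h0 => by simpa using congrFun h0 0⟩
    rw [Matrix.toLin'_apply, hmul]
    ext i
    fin_cases i
    · simp
    · simp; ring
    · simp; ring
    · simp; ring
    · simp [← h]; ring

/-- The polynomial of degree at most five with the given coefficients. -/
def quintic (c : Fin 6 → ℝ) : ℝ[X] := ∑ i, Polynomial.C (c i) * Polynomial.X ^ (i : ℕ)

theorem quintic_hermite_step (c₀ c₁ c₂ c₃ c₄ r t : ℝ) :
    (Polynomial.X - Polynomial.C r) * quintic ![c₀, c₁, c₂, c₃, c₄, 0] -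
      Polynomial.C t * (quintic ![c₀, c₁, c₂, c₃, c₄, 0]).derivative =
    quintic ![-r * c₀ - t * c₁, c₀ - r * c₁ - 2 * t * c₂, c₁ - r * c₂ - 3 * t * c₃,
      c₂ - r * c₃ - 4 * t * c₄, c₃ - r * c₄, c₄] := by
  refine Polynomial.funext fun x => ?_
  simp [quintic, Fin.sum_univ_six, Polynomial.derivative_pow]
  ring

theorem quintic_sub_derivative (c₀ c₁ c₂ c₃ c₄ c₅ t : ℝ) :
    quintic ![c₀, c₁, c₂, c₃, c₄, c₅] -
      Polynomial.C t * (quintic ![c₀, c₁, c₂, c₃, c₄, c₅]).derivative =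
    quintic ![c₀ - t * c₁, c₁ - 2 * t * c₂, c₂ - 3 * t * c₃, c₃ - 4 * t * c₄,
      c₄ - 5 * t * c₅, c₅] := by
  refine Polynomial.funext fun x => ?_
  simp [quintic, Fin.sum_univ_six, Polynomial.derivative_pow]
  ring

/-- The coefficients `a_0, …, a_4` of the closure with nodes `u, v`, auxiliary root `r` and squared
width `s`: `x ^ 5 - ∑ a_j x ^ j` is mapped to `(x - u)² (x - v)² (x - r)` by
`1 + s ∂² / 2 + κ s² ∂⁴ / 24`. -/
def nodeCoeff (κ u v r s : ℝ) : Fin 5 → ℝ :=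
  let e₁ := 2 * u + 2 * v + r
  let e₂ := u ^ 2 + 4 * u * v + v ^ 2 + 2 * (u + v) * r
  let e₃ := 2 * u * v * (u + v) + (u ^ 2 + 4 * u * v + v ^ 2) * r
  let e₄ := u ^ 2 * v ^ 2 + 2 * u * v * (u + v) * r
  let e₅ := u ^ 2 * v ^ 2 * r
  ![e₅ - s * e₃ + (6 - κ) * s ^ 2 * e₁, -e₄ + 3 * s * e₂ - (30 - 5 * κ) * s ^ 2, e₃ - 6 * s * e₁,
    10 * s - e₂, e₁]

theorem hasSimpleRealRoots_nodeCoeff {κ : ℝ} (h3 : 3 ≤ κ) (h6 : κ < 6) (u v r : ℝ) {s : ℝ}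
    (hs : 0 < s) :
    HasSimpleRealRoots 5 (quintic (Fin.snoc (-nodeCoeff κ u v r s) 1)) := by
  -- Here g² = bs, and t = s - 2g² is positive exactly because κ < 6 gives b < 1/2.
  obtain ⟨b, hb0, hb⟩ : ∃ b, 0 ≤ b ∧ 12 * b ^ 2 = κ - 3 :=
    ⟨√((κ - 3) / 12), Real.sqrt_nonneg _, by rw [Real.sq_sqrt (by linarith)]; ring⟩
  have hb2 : b < 1 / 2 := by nlinarith
  obtain ⟨g, hg⟩ : ∃ g, g ^ 2 = b * s := ⟨√(b * s), Real.sq_sqrt (by positivity)⟩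
  have ht : 0 < s - 2 * g ^ 2 := by nlinarith
  have hκ : κ * s ^ 2 = 3 * s ^ 2 + 12 * g ^ 4 := by
    linear_combination -s ^ 2 * hb - 12 * (g ^ 2 + b * s) * hg
  have h1 : HasSimpleRealRoots 1 (quintic ![-u, 1, 0, 0, 0, 0]) := by
    convert HasSimpleRealRoots.X_sub_C u using 1
    simp [quintic, Fin.sum_univ_six]
    ring
  have h2 := h1.hermite_step u ht
  rw [quintic_hermite_step] at h2
  simp only [mul_zero, sub_zero] at h2
  have h3 := h2.hermite_step v ht
  rw [quintic_hermite_step] at h3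
  simp only [mul_zero, sub_zero] at h3
  have h4 := h3.hermite_step v ht
  rw [quintic_hermite_step] at h4
  simp only [mul_zero, sub_zero] at h4
  have h5 := h4.hermite_step r ht
  rw [quintic_hermite_step] at h5
  have h6 := h5.sub_derivative g
  rw [quintic_sub_derivative] at h6
  have h7 := h6.sub_derivative (-g)
  rw [quintic_sub_derivative] at h7
  convert h7 using 2
  ext i
  refine Fin.lastCases ?_ (fun i => ?_) i
  · rw [Fin.snoc_last]
    simp
  · rw [Fin.snoc_castSucc]
    clear h1 h2 h3 h4 h5 h6 h7
    fin_cases i <;> simp [nodeCoeff]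
    · linear_combination (2 * u + 2 * v + r) * hκ
    · linear_combination -5 * hκ
    · ring
    · ring
    · ring


/-! ### Gradients of the moments and the chain-rule equations -/

/-- The derivatives `∂Δ_j / ∂u`. -/
def explicitDeltaDeriv (κ u σ : ℝ) : Fin 6 → ℝ :=
  ![0, 1, 2 * u, 3 * u ^ 2 + 3 * σ ^ 2, 4 * u ^ 3 + 12 * u * σ ^ 2,
    5 * u ^ 4 + 30 * u ^ 2 * σ ^ 2 + 5 * κ * σ ^ 4]

/-- The derivatives `∂Δ_j / ∂σ`. -/
def explicitDeltaWidthDeriv (κ u σ : ℝ) : Fin 6 → ℝ :=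
  ![0, 0, 2 * σ, 6 * u * σ, 12 * u ^ 2 * σ + 4 * κ * σ ^ 3, 20 * u ^ 3 * σ + 20 * κ * u * σ ^ 3]

/-- The gradient of `M_j`. -/
def explicitGrad (κ : ℝ) (j : Fin 6) (W : Fin 5 → ℝ) : Fin 5 → ℝ :=
  ![explicitDelta κ (W 1) (W 4) j, W 0 * explicitDeltaDeriv κ (W 1) (W 4) j,
    explicitDelta κ (W 3) (W 4) j, W 2 * explicitDeltaDeriv κ (W 3) (W 4) j,
    W 0 * explicitDeltaWidthDeriv κ (W 1) (W 4) j + W 2 * explicitDeltaWidthDeriv κ (W 3) (W 4) j]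

theorem hasStrictFDerivAt_explicitDelta {E : Type*} [NormedAddCommGroup E] [NormedSpace ℝ E]
    (κ : ℝ) (j : Fin 6) {u σ : E → ℝ} {u' σ' : E →L[ℝ] ℝ} {x : E}
    (hu : HasStrictFDerivAt u u' x) (hσ : HasStrictFDerivAt σ σ' x) :
    HasStrictFDerivAt (fun y => explicitDelta κ (u y) (σ y) j)
      (explicitDeltaDeriv κ (u x) (σ x) j • u' + explicitDeltaWidthDeriv κ (u x) (σ x) j • σ') x := by
  fin_cases j
  · refine (hasStrictFDerivAt_const (𝕜 := ℝ) (1 : ℝ) x).congr_fderiv ?_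
    ext; simp [explicitDeltaDeriv, explicitDeltaWidthDeriv]
  · refine hu.congr_fderiv ?_
    ext; simp [explicitDeltaDeriv, explicitDeltaWidthDeriv]
  · refine ((hu.pow 2).add (hσ.pow 2)).congr_fderiv ?_
    ext; simp [explicitDeltaDeriv, explicitDeltaWidthDeriv]
  · refine ((hu.pow 3).add ((hu.const_mul 3).mul (hσ.pow 2))).congr_fderiv ?_
    ext; simp [explicitDeltaDeriv, explicitDeltaWidthDeriv]; ring
  · refine (((hu.pow 4).add (((hu.pow 2).const_mul 6).mul (hσ.pow 2))).add
      ((hσ.pow 4).const_mul κ)).congr_fderiv ?_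
    ext; simp [explicitDeltaDeriv, explicitDeltaWidthDeriv]; ring
  · refine (((hu.pow 5).add (((hu.pow 3).const_mul 10).mul (hσ.pow 2))).add
      ((hu.const_mul (5 * κ)).mul (hσ.pow 4))).congr_fderiv ?_
    ext; simp [explicitDeltaDeriv, explicitDeltaWidthDeriv]; ring

theorem hasStrictFDerivAt_explicitMoment (κ : ℝ) (j : Fin 6) (W : Fin 5 → ℝ) :
    HasStrictFDerivAt (explicitMoment κ j)
      (∑ k, explicitGrad κ j W k • (ContinuousLinearMap.proj k : (Fin 5 → ℝ) →L[ℝ] ℝ)) W := by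
  have h : ∀ k : Fin 5, HasStrictFDerivAt (fun W : Fin 5 → ℝ => W k)
      (ContinuousLinearMap.proj k : (Fin 5 → ℝ) →L[ℝ] ℝ) W :=
    fun k => (ContinuousLinearMap.proj k : (Fin 5 → ℝ) →L[ℝ] ℝ).hasStrictFDerivAt
  refine (((h 0).mul (hasStrictFDerivAt_explicitDelta κ j (h 1) (h 4))).add
    ((h 2).mul (hasStrictFDerivAt_explicitDelta κ j (h 3) (h 4)))).congr_fderiv ?_
  ext v
  simp [explicitGrad, Fin.sum_univ_five]
  ring

/-- A cubic with two distinct double roots vanishes. -/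
theorem cubic_eq_zero {c₀ c₁ c₂ c₃ u v : ℝ} (huv : u ≠ v)
    (hu : c₀ + c₁ * u + c₂ * u ^ 2 + c₃ * u ^ 3 = 0)
    (hv : c₀ + c₁ * v + c₂ * v ^ 2 + c₃ * v ^ 3 = 0)
    (hu' : c₁ + 2 * c₂ * u + 3 * c₃ * u ^ 2 = 0)
    (hv' : c₁ + 2 * c₂ * v + 3 * c₃ * v ^ 2 = 0) :
    c₀ = 0 ∧ c₁ = 0 ∧ c₂ = 0 ∧ c₃ = 0 := by
  have hd : v - u ≠ 0 := sub_ne_zero.2 huv.symm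
  have h3 : c₃ = 0 := by
    have : c₃ * (v - u) ^ 3 = 0 := by
      linear_combination (v - u) * (hu' + hv') - 2 * (hv - hu)
    exact (mul_eq_zero.1 this).resolve_right (pow_ne_zero _ hd)
  subst h3
  have h2 : c₂ = 0 := by
    have : c₂ * (v - u) = 0 := by linear_combination (hv' - hu') / 2
    exact (mul_eq_zero.1 this).resolve_right hd
  subst h2
  have h1 : c₁ = 0 := by linarith
  subst h1
  exact ⟨by linarith, rfl, rfl, rfl⟩

/-- For B = ∑ b_j xʲ, the weight and node equations give DB = b₄(x - u)²(x - v)². The σ-equation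
then reads b₄ times a multiple of (v - u)² + 2(κ - 3)σ², which is positive, so b₄ = 0. -/
theorem eq_zero_of_explicitGrad {κ : ℝ} (hκ : 3 ≤ κ) {W : Fin 5 → ℝ} (hW : W ∈ Omega)
    {b : Fin 5 → ℝ} (hb : ∀ k, ∑ j : Fin 5, b j * explicitGrad κ j.castSucc W k = 0) : b = 0 := by
  obtain ⟨h1, h2, hu, hσ⟩ := hW
  have e0 := hb 0
  have e1 := hb 1
  have e2 := hb 2
  have e3 := hb 3
  have e4 := hb 4
  simp [explicitGrad, Fin.sum_univ_five, explicitDelta, explicitDeltaDeriv,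
    explicitDeltaWidthDeriv] at e0 e1 e2 e3 e4
  set w := W 0
  set u := W 1
  set w' := W 2
  set v := W 3
  set σ := W 4
  have e1' : b 1 + b 2 * (2 * u) + b 3 * (3 * u ^ 2 + 3 * σ ^ 2) +
      b 4 * (4 * u ^ 3 + 12 * u * σ ^ 2) = 0 :=
    mul_left_cancel₀ h1.ne' (by linear_combination e1)
  have e3' : b 1 + b 2 * (2 * v) + b 3 * (3 * v ^ 2 + 3 * σ ^ 2) +
      b 4 * (4 * v ^ 3 + 12 * v * σ ^ 2) = 0 :=
    mul_left_cancel₀ h2.ne' (by linear_combination e3)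
  obtain ⟨f0, f1, f2, f3⟩ := cubic_eq_zero (u := u) (v := v)
    (c₀ := b 0 + σ ^ 2 * b 2 + κ * σ ^ 4 * b 4 - b 4 * u ^ 2 * v ^ 2)
    (c₁ := b 1 + 3 * σ ^ 2 * b 3 + 2 * b 4 * u * v * (u + v))
    (c₂ := b 2 + 6 * σ ^ 2 * b 4 - b 4 * (u ^ 2 + 4 * u * v + v ^ 2))
    (c₃ := b 3 + 2 * b 4 * (u + v)) hu.ne (by linear_combination e0) (by linear_combination e2)
    (by linear_combination e1') (by linear_combination e3')
  have hb4 : b 4 = 0 := by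
    have hpos : 0 < 2 * σ * ((w + w') * ((v - u) ^ 2 + 2 * (κ - 3) * σ ^ 2)) := by
      have : 0 < (v - u) ^ 2 := pow_pos (sub_pos.2 hu) 2
      have : 0 ≤ (κ - 3) * σ ^ 2 := mul_nonneg (by linarith) (sq_nonneg σ)
      exact mul_pos (by linarith) (mul_pos (by linarith) (by linarith))
    refine (mul_eq_zero.1 (?_ : b 4 * (2 * σ * ((w + w') * ((v - u) ^ 2 +
      2 * (κ - 3) * σ ^ 2))) = 0)).resolve_right hpos.ne'
    linear_combination e4 - 2 * σ * (w + w') * f2 - 6 * σ * (w * u + w' * v) * f3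
  rw [hb4] at f0 f1 f2 f3
  have hb3 : b 3 = 0 := by linarith
  have hb2 : b 2 = 0 := by linarith
  rw [hb3] at f1
  rw [hb2] at f0
  ext j
  fin_cases j
  · change b 0 = 0; linarith
  · change b 1 = 0; linarith
  · exact hb2
  · exact hb3
  · exact hb4

/-- The simple root of the polynomial `(x - u₁)² (x - u₂)² (x - r)` attached to the closure. -/
def auxRoot (κ : ℝ) (W : Fin 5 → ℝ) : ℝ :=
  let c := (W 0 * W 1 + W 2 * W 3) / (W 0 + W 2)
  let d := (W 3 - W 1) ^ 2
  let e := (κ - 3) * W 4 ^ 2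
  -- For κ = 3 the quotient would be 0/0 at coinciding nodes; `c` is its continuous extension.
  if κ = 3 then c else (d * c + e * (10 * c - 4 * (W 1 + W 3))) / (d + 2 * e)

theorem auxRoot_spec {κ : ℝ} (hκ : 3 ≤ κ) {W : Fin 5 → ℝ} (hW : W ∈ OmegaTot) :
    (W 0 + W 2) * ((W 3 - W 1) ^ 2 + 2 * ((κ - 3) * W 4 ^ 2)) * auxRoot κ W =
      (W 3 - W 1) ^ 2 * (W 0 * W 1 + W 2 * W 3) + (κ - 3) * W 4 ^ 2 *
        (10 * (W 0 * W 1 + W 2 * W 3) - 4 * (W 0 + W 2) * (W 1 + W 3)) := by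
  obtain ⟨h1, h2, hu, hσ⟩ := hW
  have hn : W 0 + W 2 ≠ 0 := by positivity
  rw [auxRoot]
  split_ifs with h
  · subst h
    field_simp
    ring
  · have : 0 < (κ - 3) * W 4 ^ 2 := mul_pos (sub_pos.2 (lt_of_le_of_ne hκ (Ne.symm h))) (pow_pos hσ 2)
    have : (W 3 - W 1) ^ 2 + 2 * (κ - 3) * W 4 ^ 2 ≠ 0 := by
      rw [mul_assoc]
      positivity
    field_simp

/-- At coinciding nodes the moments do not see how the weight is split; independence of the split
makes the coefficients a function of the moments. -/
theorem auxRoot_of_eq {κ : ℝ} {W : Fin 5 → ℝ} (hW : W ∈ OmegaTot) (hu : W 3 = W 1) :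
    auxRoot κ W = W 1 := by
  obtain ⟨h1, h2, -, hσ⟩ := hW
  have hn : W 0 + W 2 ≠ 0 := by positivity
  rw [auxRoot]
  have hc : (W 0 * W 1 + W 2 * W 1) / (W 0 + W 2) = W 1 := by field_simp
  simp only [hu, hc]
  split_ifs with h
  · rfl
  · have : κ - 3 ≠ 0 := sub_ne_zero.2 h
    field_simp
    ring

theorem continuousOn_auxRoot {κ : ℝ} (hκ : 3 ≤ κ) : ContinuousOn (auxRoot κ) OmegaTot := by
  have hc : ContinuousOn (fun W : Fin 5 → ℝ => (W 0 * W 1 + W 2 * W 3) / (W 0 + W 2)) OmegaTot :=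
    ContinuousOn.div (by fun_prop) (by fun_prop) fun W hW => (add_pos hW.1 hW.2.1).ne'
  by_cases h : κ = 3
  · exact hc.congr fun W _ => if_pos h
  · refine ContinuousOn.congr (f := fun W : Fin 5 → ℝ => ((W 3 - W 1) ^ 2 *
      ((W 0 * W 1 + W 2 * W 3) / (W 0 + W 2)) + (κ - 3) * W 4 ^ 2 *
        (10 * ((W 0 * W 1 + W 2 * W 3) / (W 0 + W 2)) - 4 * (W 1 + W 3))) /
          ((W 3 - W 1) ^ 2 + 2 * ((κ - 3) * W 4 ^ 2))) ?_ fun W _ => if_neg h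
    refine ContinuousOn.div (by fun_prop) (by fun_prop) fun W hW => ?_
    have : 0 < (κ - 3) * W 4 ^ 2 :=
      mul_pos (sub_pos.2 (lt_of_le_of_ne hκ (Ne.symm h))) (pow_pos hW.2.2.2 2)
    positivity

/-- The coefficients of the closed system in terms of the parameters. -/
def closureCoeff (κ : ℝ) (W : Fin 5 → ℝ) : Fin 5 → ℝ :=
  nodeCoeff κ (W 1) (W 3) (auxRoot κ W) (W 4 ^ 2)

theorem continuousOn_closureCoeff {κ : ℝ} (hκ : 3 ≤ κ) :
    ContinuousOn (closureCoeff κ) OmegaTot := by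
  have hr := continuousOn_auxRoot hκ
  refine continuousOn_pi.2 fun j => ?_
  fin_cases j <;> simp [closureCoeff, nodeCoeff] <;> fun_prop

/-- The weight and node equations hold for every value of the simple root; only the σ-equation uses
`auxRoot_spec`. -/
theorem closureCoeff_mul_explicitGrad {κ : ℝ} (hκ : 3 ≤ κ) {W : Fin 5 → ℝ} (hW : W ∈ OmegaTot)
    (k : Fin 5) :
    ∑ j : Fin 5, closureCoeff κ W j * explicitGrad κ j.castSucc W k = explicitGrad κ 5 W k := by
  have hr := auxRoot_spec hκ hW
  rw [closureCoeff]
  generalize auxRoot κ W = r at *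
  rw [Fin.sum_univ_five]
  fin_cases k <;>
    simp [explicitGrad, explicitDelta, explicitDeltaDeriv, explicitDeltaWidthDeriv, nodeCoeff]
  · ring
  · ring
  · ring
  · ring
  · linear_combination (2 * W 4) * hr

theorem eq_closureCoeff {κ : ℝ} (hκ : 3 ≤ κ) {W : Fin 5 → ℝ} (hW : W ∈ Omega) {a : Fin 5 → ℝ}
    (ha : ∀ k, ∑ j : Fin 5, a j * explicitGrad κ j.castSucc W k = explicitGrad κ 5 W k) :
    a = closureCoeff κ W := by
  have hW' : W ∈ OmegaTot := ⟨hW.1, hW.2.1, hW.2.2.1.le, hW.2.2.2⟩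
  refine sub_eq_zero.1 (eq_zero_of_explicitGrad hκ hW fun k => ?_)
  simp only [Pi.sub_apply, sub_mul, Finset.sum_sub_distrib, ha,
    closureCoeff_mul_explicitGrad hκ hW', sub_self]


/-! ### The closure and its coefficients as functions of the moments -/

theorem Omega_subset_OmegaTot : Omega ⊆ OmegaTot :=
  fun _ hW => ⟨hW.1, hW.2.1, hW.2.2.1.le, hW.2.2.2⟩

theorem isOpen_Omega : IsOpen Omega := by
  have h : Omega = {W : Fin 5 → ℝ | 0 < W 0} ∩ ({W | 0 < W 2} ∩ ({W | W 1 < W 3} ∩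
      {W | 0 < W 4})) := rfl
  rw [h]
  exact (isOpen_lt (by fun_prop) (by fun_prop)).inter ((isOpen_lt (by fun_prop) (by fun_prop)).inter
    ((isOpen_lt (by fun_prop) (by fun_prop)).inter (isOpen_lt (by fun_prop) (by fun_prop))))

theorem OmegaTot_subset_closure : OmegaTot ⊆ closure Omega := by
  intro W hW
  have hc : Continuous fun ε : ℝ => Function.update W 3 (W 3 + ε) :=
    continuous_const.update 3 (by fun_prop)
  have ht : Tendsto (fun ε : ℝ => Function.update W 3 (W 3 + ε)) (𝓝[>] 0) (𝓝 W) := by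
    have := hc.tendsto 0
    simp only [add_zero, Function.update_eq_self] at this
    exact this.mono_left nhdsWithin_le_nhds
  refine mem_closure_of_tendsto ht ?_
  filter_upwards [self_mem_nhdsWithin] with ε hε
  obtain ⟨h1, h2, h3, h4⟩ := hW
  have hε : 0 < ε := hε
  refine ⟨?_, ?_, ?_, ?_⟩ <;> simp [Function.update] <;> linarith

/-- The Jacobian matrix of the moment map. -/
def jacobian (κ : ℝ) (W : Fin 5 → ℝ) : Matrix (Fin 5) (Fin 5) ℝ :=
  Matrix.of fun j k => explicitGrad κ j.castSucc W k

theorem isUnit_jacobian {κ : ℝ} (hκ : 3 ≤ κ) {W : Fin 5 → ℝ} (hW : W ∈ Omega) :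
    IsUnit (jacobian κ W) := by
  rw [← Matrix.vecMul_injective_iff_isUnit]
  refine (injective_iff_map_eq_zero (Matrix.vecMulLinear (jacobian κ W))).2 fun b hb => ?_
  exact eq_zero_of_explicitGrad hκ hW fun k => congrFun hb k

variable {K : ℝ → ℝ}

theorem hasStrictFDerivAt_momentMap (hK : IsNormalizedKernel K) (heven : ∀ ξ, K (-ξ) = K ξ)
    {W : Fin 5 → ℝ} (hW : W ∈ Omega) :
    HasStrictFDerivAt (momentMap K)
      (Matrix.toLin' (jacobian (moment K 4) W)).toContinuousLinearMap W := by
  have h : HasStrictFDerivAt (fun W (j : Fin 5) => explicitMoment (moment K 4) j.castSucc W)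
      (Matrix.toLin' (jacobian (moment K 4) W)).toContinuousLinearMap W := by
    refine hasStrictFDerivAt_pi'.2 fun j => ?_
    refine (hasStrictFDerivAt_explicitMoment (moment K 4) j.castSucc W).congr_fderiv ?_
    ext v
    simp [jacobian, Matrix.mulVec, dotProduct]
  refine h.congr_of_eventuallyEq ?_
  filter_upwards [isOpen_Omega.mem_nhds hW] with V hV
  exact (momentMap_eq hK heven hV.2.2.2).symm

theorem hasFDerivAt_ansatzMoment_five (hK : IsNormalizedKernel K) (heven : ∀ ξ, K (-ξ) = K ξ)
    {W : Fin 5 → ℝ} (hW : W ∈ Omega) :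
    HasFDerivAt (ansatzMoment K 5) (∑ k, explicitGrad (moment K 4) 5 W k •
      (ContinuousLinearMap.proj k : (Fin 5 → ℝ) →L[ℝ] ℝ)) W := by
  refine (hasStrictFDerivAt_explicitMoment (moment K 4) 5 W).hasFDerivAt.congr_of_eventuallyEq ?_
  filter_upwards [isOpen_Omega.mem_nhds hW] with V hV
  exact ansatzMoment_eq hK heven 5 hV.2.2.2

theorem sum_smul_proj_comp_jacobian (a : Fin 5 → ℝ) (κ : ℝ) (W : Fin 5 → ℝ) :
    (∑ j, a j • (ContinuousLinearMap.proj j : (Fin 5 → ℝ) →L[ℝ] ℝ)).comp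
      (Matrix.toLin' (jacobian κ W)).toContinuousLinearMap =
    ∑ k, (∑ j : Fin 5, a j * explicitGrad κ j.castSucc W k) •
      (ContinuousLinearMap.proj k : (Fin 5 → ℝ) →L[ℝ] ℝ) := by
  ext v
  simp [jacobian, Matrix.mulVec, dotProduct, Finset.mul_sum, Finset.sum_mul]
  rw [Finset.sum_comm]
  simp only [mul_assoc]

/-- Any coefficients of the closed system are the explicit ones. -/
theorem IsCoefficients.eqOn (hK : IsNormalizedKernel K) (heven : ∀ ξ, K (-ξ) = K ξ)
    (hκ : 3 ≤ moment K 4) {F : (Fin 5 → ℝ) → ℝ} {a : (Fin 5 → ℝ) → (Fin 5 → ℝ)}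
    (hF : IsClosure K F) (ha : IsCoefficients K F a) :
    Set.EqOn (fun W => a (momentMap K W)) (closureCoeff (moment K 4)) OmegaTot := by
  refine Set.EqOn.of_subset_closure (s := Omega) ?_ ha.continuousOn (continuousOn_closureCoeff hκ)
    Omega_subset_OmegaTot OmegaTot_subset_closure
  intro W hW
  refine eq_closureCoeff hκ hW fun k => ?_
  have h1 := (ha.hasFDerivAt W hW).comp W (hasStrictFDerivAt_momentMap hK heven hW).hasFDerivAt
  rw [sum_smul_proj_comp_jacobian] at h1
  have h2 : HasFDerivAt (F ∘ momentMap K) _ W :=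
    (hasFDerivAt_ansatzMoment_five hK heven hW).congr_of_eventuallyEq (by
      filter_upwards [isOpen_Omega.mem_nhds hW] with V hV
      exact hF V (Omega_subset_OmegaTot hV))
  have h3 := DFunLike.congr_fun (h1.unique h2) (Pi.single k 1)
  simpa [Pi.single_apply] using h3

theorem momentMap_eq_imp (hK : IsNormalizedKernel K) (heven : ∀ ξ, K (-ξ) = K ξ)
    (hκ : 3 ≤ moment K 4) {W W' : Fin 5 → ℝ} (hW : W ∈ OmegaTot) (hW' : W' ∈ OmegaTot)
    (h : momentMap K W = momentMap K W') :
    W = W' ∨ (W 4 = W' 4 ∧ W 0 + W 2 = W' 0 + W' 2 ∧ W 3 = W 1 ∧ W' 1 = W 1 ∧ W' 3 = W 1) := by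
  rw [momentMap_eq hK heven hW.2.2.2, momentMap_eq hK heven hW'.2.2.2] at h
  have m0 := congrFun h 0
  have m1 := congrFun h 1
  have m2 := congrFun h 2
  have m3 := congrFun h 3
  have m4 := congrFun h 4
  simp [explicitMoment, explicitDelta] at m0 m1 m2 m3 m4
  obtain ⟨h1, h2, hu, hσ⟩ := hW
  obtain ⟨h1', h2', hu', hσ'⟩ := hW'
  obtain ⟨e, ⟨e0, e1, e2, e3⟩ | ⟨e1, e2, e3⟩⟩ :=
    parameters_eq hκ h1 h2 hu hσ h1' h2' hu' hσ' m0 m1 m2 m3 m4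
  · left
    ext i
    fin_cases i <;> assumption
  · exact Or.inr ⟨e, m0, e1.symm, e2, e3⟩

theorem injOn_momentMap (hK : IsNormalizedKernel K) (heven : ∀ ξ, K (-ξ) = K ξ)
    (hκ : 3 ≤ moment K 4) : Set.InjOn (momentMap K) Omega := by
  intro W hW W' hW' h
  refine (momentMap_eq_imp hK heven hκ (Omega_subset_OmegaTot hW) (Omega_subset_OmegaTot hW')
    h).resolve_right fun h => ?_
  exact hW.2.2.1.ne' h.2.2.1

/-- A function of the parameters that agrees whenever the moments do is a function of the
moments. -/
theorem exists_eq_comp_momentMap {β : Type*} [Nonempty β] {f : (Fin 5 → ℝ) → β}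
    (hf : ∀ W ∈ OmegaTot, ∀ W' ∈ OmegaTot, momentMap K W = momentMap K W' → f W = f W') :
    ∃ F : (Fin 5 → ℝ) → β, ∀ W ∈ OmegaTot, F (momentMap K W) = f W := by
  refine ⟨fun M => f (Function.invFunOn (momentMap K) OmegaTot M), fun W hW => ?_⟩
  have hex : ∃ V ∈ OmegaTot, momentMap K V = momentMap K W := ⟨W, hW, rfl⟩
  exact hf _ (Function.invFunOn_mem hex) W hW (Function.invFunOn_eq hex)

theorem exists_isClosure (hK : IsNormalizedKernel K) (heven : ∀ ξ, K (-ξ) = K ξ)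
    (hκ : 3 ≤ moment K 4) : ∃ F, IsClosure K F := by
  refine exists_eq_comp_momentMap fun W hW W' hW' h => ?_
  rcases momentMap_eq_imp hK heven hκ hW hW' h with rfl | ⟨e, e0, e1, e2, e3⟩
  · rfl
  · have h1 := ansatzMoment_eq hK heven 5 hW.2.2.2
    have h2 := ansatzMoment_eq hK heven 5 hW'.2.2.2
    rw [explicitMoment, e1, ← add_mul] at h1
    rw [explicitMoment, e3, e2, ← add_mul, ← e0, ← e] at h2
    exact h1.trans h2.symm

theorem exists_coefficients (hK : IsNormalizedKernel K) (heven : ∀ ξ, K (-ξ) = K ξ)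
    (hκ : 3 ≤ moment K 4) :
    ∃ a : (Fin 5 → ℝ) → (Fin 5 → ℝ), ∀ W ∈ OmegaTot,
      a (momentMap K W) = closureCoeff (moment K 4) W := by
  refine exists_eq_comp_momentMap fun W hW W' hW' h => ?_
  rcases momentMap_eq_imp hK heven hκ hW hW' h with rfl | ⟨e, -, e1, e2, e3⟩
  · rfl
  · rw [closureCoeff, closureCoeff, auxRoot_of_eq hW e1, auxRoot_of_eq hW' (e3.trans e2.symm),
      e1, e2, e3, e]

theorem IsClosure.hasFDerivAt (hK : IsNormalizedKernel K) (heven : ∀ ξ, K (-ξ) = K ξ)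
    (hκ : 3 ≤ moment K 4) {F : (Fin 5 → ℝ) → ℝ} (hF : IsClosure K F) {W : Fin 5 → ℝ}
    (hW : W ∈ Omega) :
    HasFDerivAt F (∑ j, closureCoeff (moment K 4) W j •
      (ContinuousLinearMap.proj j : (Fin 5 → ℝ) →L[ℝ] ℝ)) (momentMap K W) := by
  set κ := moment K 4
  have hinj : Function.Injective (Matrix.toLin' (jacobian κ W)) := by
    have := Matrix.mulVec_injective_iff_isUnit.2 (isUnit_jacobian hκ hW)
    exact this
  set e : (Fin 5 → ℝ) ≃L[ℝ] (Fin 5 → ℝ) :=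
    (LinearEquiv.ofInjectiveEndo _ hinj).toContinuousLinearEquiv
  have he : (e : (Fin 5 → ℝ) →L[ℝ] (Fin 5 → ℝ)) =
      (Matrix.toLin' (jacobian κ W)).toContinuousLinearMap := by
    ext v : 1
    rfl
  have hM : HasStrictFDerivAt (momentMap K) (e : (Fin 5 → ℝ) →L[ℝ] (Fin 5 → ℝ)) W := by
    rw [he]
    exact hasStrictFDerivAt_momentMap hK heven hW
  set g := hM.localInverse (momentMap K) e W
  have hg : HasFDerivAt g (e.symm : (Fin 5 → ℝ) →L[ℝ] (Fin 5 → ℝ)) (momentMap K W) :=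
    hM.to_localInverse.hasFDerivAt
  have hgW : g (momentMap K W) = W := hM.localInverse_apply_image
  have h5 : HasFDerivAt (ansatzMoment K 5) (∑ k, explicitGrad κ 5 W k •
      (ContinuousLinearMap.proj k : (Fin 5 → ℝ) →L[ℝ] ℝ)) (g (momentMap K W)) := by
    rw [hgW]
    exact hasFDerivAt_ansatzMoment_five hK heven hW
  have hcomp := h5.comp (momentMap K W) hg
  -- Near the base point the local inverse `g` takes values in `Omega`, where the closure identity
  -- applies.
  have hev : F =ᶠ[𝓝 (momentMap K W)] ansatzMoment K 5 ∘ g := by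
    have hc : Tendsto g (𝓝 (momentMap K W)) (𝓝 W) := by
      have := hg.continuousAt.tendsto
      rwa [hgW] at this
    filter_upwards [hM.eventually_right_inverse, hc (isOpen_Omega.mem_nhds hW)] with y hy hy'
    rw [Function.comp_apply, ← hF _ (Omega_subset_OmegaTot hy')]
    exact congrArg F hy.symm
  refine (hcomp.congr_of_eventuallyEq hev).congr_fderiv ?_
  simp only [← closureCoeff_mul_explicitGrad hκ (Omega_subset_OmegaTot hW)]
  rw [← sum_smul_proj_comp_jacobian, ← he, ContinuousLinearMap.comp_assoc]
  ext v
  simp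

/-! ### Eigenvalues and the two implications -/

theorem hasDistinctRealEigenvalues_closureCoeff {κ : ℝ} (h3 : 3 ≤ κ) (h6 : κ < 6)
    {W : Fin 5 → ℝ} (hW : W ∈ OmegaTot) :
    HasDistinctRealEigenvalues (coeffMatrix (closureCoeff κ W)) := by
  obtain ⟨x, hx, hp⟩ := hasSimpleRealRoots_nodeCoeff h3 h6 (W 1) (W 3) (auxRoot κ W)
    (pow_pos hW.2.2.2 2)
  refine ⟨x, hx.injective, fun i => (hasEigenvalue_coeffMatrix_iff _ _).2 ?_⟩
  have h0 : (Lagrange.nodal Finset.univ x).eval (x i) = 0 :=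
    Lagrange.eval_nodal_at_node (Finset.mem_univ i)
  rw [← hp] at h0
  rw [closureCoeff]
  generalize nodeCoeff κ (W 1) (W 3) (auxRoot κ W) (W 4 ^ 2) = c at *
  simp only [quintic, Fin.sum_univ_castSucc, Fin.snoc_castSucc, Fin.snoc_last] at h0 ⊢
  simp at h0 ⊢
  linear_combination h0

/-- For coinciding nodes and `κ ≥ 6` the coefficient matrix has at most three real eigenvalues. -/
theorem not_hasDistinctRealEigenvalues_nodeCoeff {κ : ℝ} (hκ : 6 ≤ κ) :
    ¬ HasDistinctRealEigenvalues (coeffMatrix (nodeCoeff κ 0 0 0 1)) := by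
  rintro ⟨l, hl, h⟩
  have hroot : ∀ i, l i * (l i ^ 4 - 10 * l i ^ 2 + (30 - 5 * κ)) = 0 := by
    intro i
    have := (hasEigenvalue_coeffMatrix_iff _ _).1 (h i)
    simp [nodeCoeff, Fin.sum_univ_five] at this
    linear_combination this
  have hq : ∀ i, l i ≠ 0 → l i ^ 4 - 10 * l i ^ 2 + (30 - 5 * κ) = 0 :=
    fun i hi => (mul_eq_zero.1 (hroot i)).resolve_left hi
  obtain ⟨i, hi⟩ : ∃ i, l i ≠ 0 := by
    by_contra! h0
    exact absurd (hl ((h0 0).trans (h0 1).symm)) (by decide)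
  -- For y = l², y(y - 10) = 5κ - 30 ≥ 0. Distinct roots y would sum to 10, so all nonzero
  -- eigenvalues share one square.
  have hge : ∀ j, l j ≠ 0 → 10 ≤ l j ^ 2 := by
    intro j hj
    have h1 : 0 < l j ^ 2 := by positivity
    by_contra! h2
    nlinarith [hq j hj, mul_pos h1 (sub_pos.2 h2)]
  have hmem : ∀ j, l j ∈ ({0, l i, -l i} : Finset ℝ) := by
    intro j
    by_cases hj : l j = 0
    · simp [hj]
    · have hs : (l j ^ 2 - l i ^ 2) * (l j ^ 2 + l i ^ 2 - 10) = 0 := by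
        linear_combination hq j hj - hq i hi
      have hne : l j ^ 2 + l i ^ 2 - 10 ≠ 0 := by linarith [hge i hi, hge j hj]
      have := (mul_eq_zero.1 hs).resolve_right hne
      rcases sq_eq_sq_iff_eq_or_eq_neg.1 (sub_eq_zero.1 this) with h | h <;> simp [h]
  have hcard := Finset.card_le_card_of_injOn (s := Finset.univ) l (fun j _ => hmem j) hl.injOn
  have : ({0, l i, -l i} : Finset ℝ).card ≤ 3 := Finset.card_le_three
  simp at hcard
  omega

theorem isStrictlyHyperbolic_of_mem (hK : IsNormalizedKernel K) (heven : ∀ ξ, K (-ξ) = K ξ)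
    (h3 : 3 ≤ moment K 4) (h6 : moment K 4 < 6) : IsStrictlyHyperbolic K := by
  obtain ⟨F, hF⟩ := exists_isClosure hK heven h3
  obtain ⟨a, ha⟩ := exists_coefficients hK heven h3
  refine ⟨F, a, hF, ⟨fun W hW => ?_, (continuousOn_closureCoeff h3).congr ha⟩, ?_⟩
  · rw [ha W (Omega_subset_OmegaTot hW)]
    exact hF.hasFDerivAt hK heven h3 hW
  · rintro _ ⟨W, hW, rfl⟩
    rw [ha W hW]
    exact hasDistinctRealEigenvalues_closureCoeff h3 h6 hW

theorem IsClosure.three_le (hK : IsNormalizedKernel K) (heven : ∀ ξ, K (-ξ) = K ξ)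
    {F : (Fin 5 → ℝ) → ℝ} (hF : IsClosure K F) : 3 ≤ moment K 4 := by
  by_contra! h
  obtain ⟨W, hW, W', hW', heq, hne⟩ := exists_explicitMoment_five_ne (moment_four_nonneg hK) h
  apply hne
  have h5 := hF W (Omega_subset_OmegaTot hW)
  have h5' := hF W' (Omega_subset_OmegaTot hW')
  rw [momentMap_eq hK heven hW.2.2.2, funext heq, ← momentMap_eq hK heven hW'.2.2.2, h5'] at h5
  exact ((ansatzMoment_eq hK heven 5 hW'.2.2.2).symm.trans
    (h5.trans (ansatzMoment_eq hK heven 5 hW.2.2.2))).symm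

theorem IsStrictlyHyperbolic.bounds (hK : IsNormalizedKernel K) (heven : ∀ ξ, K (-ξ) = K ξ)
    (h : IsStrictlyHyperbolic K) : 3 ≤ moment K 4 ∧ moment K 4 < 6 := by
  obtain ⟨F, a, hF, ha, hE⟩ := h
  have h3 := hF.three_le hK heven
  refine ⟨h3, ?_⟩
  by_contra! h6
  have hW : (![1, 0, 1, 0, 1] : Fin 5 → ℝ) ∈ OmegaTot := by simp [OmegaTot]
  have h := hE _ ⟨_, hW, rfl⟩
  have hc := ha.eqOn hK heven h3 hF hW
  simp only at hc
  rw [hc, closureCoeff, auxRoot_of_eq hW rfl] at h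
  exact not_hasDistinctRealEigenvalues_nodeCoeff h6 (by simpa using h)

end EQMOM
end

theorem mainTheorem4 (K : ℝ → ℝ) (hK : EQMOM.IsNormalizedKernel K)
    (heven : ∀ ξ, K (-ξ) = K ξ) :
    (EQMOM.IsStrictlyHyperbolic K ↔ 3 ≤ EQMOM.moment K 4 ∧ EQMOM.moment K 4 < 6) ∧
      (EQMOM.IsStrictlyHyperbolic K → Set.InjOn (EQMOM.momentMap K) EQMOM.Omega) :=
  ⟨⟨fun h => h.bounds hK heven, fun h => EQMOM.isStrictlyHyperbolic_of_mem hK heven h.1 h.2⟩,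
    fun h => EQMOM.injOn_momentMap hK heven (h.bounds hK heven).1⟩
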